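/- \textbf{Setting.} Let $\mathbb Y$ be a finite set with transition matrix $P_{Y'|Y}$, let $P_X$ be a probability measure on a measurable space $\mathbb X$, and put $\mathbb W=\mathbb X\times\mathbb Y$. Given a history $w^t=(w_0,\dots,w_t)$, $w_s=(x_s,y_s)$, the next state $W_{t+1}=(X_{t+1},Y_{t+1})$ has law $P_X\otimes P_{Y'|Y}(\cdot\mid y_t)$; $E[\cdot\mid w^t]$ is the expectation over infinite histories given $W^t=w^t$, and $E_Y[\cdot\mid y]$, $E_X$ are expectations under $P_{Y'|Y}(\cdot\mid y)$ and $P_X$. Let $\gamma\in(0,1)$, $\theta\in(0,+\infty]$, and let $\mathbf c=(c_t)_t$ be a consumption plan of the lender, i.e. $c_t(w^t)$ is a real measurable function of $w^t$, that is bounded: $|c_t(w^t)|\le C<\infty$ for all $t,w^t$. (Feasible plans are bounded, because bond holdings and prices are; nothing else about feasibility is used.) For $y\in\mathbb Y$ let $\mathcal M_y=\{g:\mathbb Y\to[0,\infty):E_Y[g(Y')\mid y]=1\}$ and $\mathcal E[g](y)=E_Y[g(Y')\log g(Y')\mid y]$ (with $0\log 0=0$). An \emph{admissible distortion} is a sequence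 $m=(m_{s+1})_{s\ge0}$ of measurable functions $m_{s+1}(y'\mid w^s)$ with $m_{s+1}(\cdot\mid w^s)\in\mathcal M_{y_s}$ for all $s,w^s$. Write $M_{t+j}/M_t:=\prod_{\tau=t+1}^{t+j}m_\tau(Y_\tau\mid W^{\tau-1})$. If $\theta=+\infty$, read $\theta\cdot0=0$. Real functions $U_t(w^t)$ \emph{satisfy the sequential problem at} $(t,w^t)$ if $$U_t(w^t)=\min_{m}\ \sum_{j=0}^\infty\gamma^jE\Big[\tfrac{M_{t+j}}{M_t}\big\{c_{t+j}(W^{t+j})+\theta\gamma\,\mathcal E[m_{t+j+1}(\cdot\mid W^{t+j})](Y_{t+j})\big\}\,\Big|\,w^t\Big],$$ the minimum being over all admissible distortions and attained (the objective is well defined in $(-\infty,+\infty]$). They \emph{satisfy SP-MA} if this holds at every $(t,w^t)$. They \emph{satisfy FP-MA} if every $U_t$ is measurable, $U_{t+1}(w^t,(\cdot,y'))$ is $P_X$-integrable for all $t,w^t,y'$, and for all $t,w^t$, with attained minimum, $$U_t(w^t)=c_t(w^t)+\gamma\min_{g\in\mathcal M_{y_t}}\Big\{E_Y\big[g(Y')\,\mathcal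 U_{t+1}(w^t,Y')\mid y_t\big]+\theta\,\mathcal E[g](y_t)\Big\},\qquad \mathcal U_{t+1}(w^t,y')=E_X\big[U_{t+1}(w^t,(X,y'))\big].$$ \textbf{Theorem S.1.} (a) If measurable functions $(U_t)_t$ satisfy SP-MA, then they satisfy FP-MA. (b) Let $(\bar U_t)_t$ satisfy FP-MA. If at some $(t,w^t)$ the transversality condition $$\lim_{T\to\infty}\gamma^{T+1}E\Big[\tfrac{M_{t+T+1}}{M_t}\,\bar U_{t+T+1}(W^{t+T+1})\,\Big|\,w^t\Big]=0\quad\text{for every admissible distortion}$$ holds (the expectations being finite), then $\bar U$ satisfies the sequential problem at $(t,w^t)$. In particular, the condition given $w_0$ (the case $t=0$) makes $\bar U_0(w_0)$ the sequential value at $w_0$; and if the condition holds at every $(t,w^t)$, then $(\bar U_t)_t$ satisfies SP-MA. -/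

import Mathlib

open MeasureTheory ProbabilityTheory Filter Topology
open scoped ENNReal

namespace MinAgent

/-- Partial histories `w^t = (w_0, …, w_t)` of `W`-valued states. -/
abbrev History (W : Type*) (t : ℕ) : Type _ := (i : Finset.Iic t) → W

/-- The last state `w_t` of the history `w^t`. -/
def History.last {W : Type*} {t : ℕ} (w : History W t) : W :=
  w ⟨t, Finset.mem_Iic.2 le_rfl⟩

/-- The history `(w^t, v)` of length one more. -/
def History.snoc {W : Type*} {t : ℕ} (w : History W t) (v : W) : History W (t + 1) :=
  fun i => if h : i.1 ≤ t then w ⟨i.1, Finset.mem_Iic.2 h⟩ else v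

/-- The partial history `w^t` of an infinite history `w^∞`. -/
def upTo {W : Type*} (t : ℕ) (ω : ℕ → W) : History W t := fun i => ω i.1

theorem measurable_last {W : Type*} [MeasurableSpace W] (t : ℕ) :
    Measurable (History.last : History W t → W) :=
  measurable_pi_apply _

noncomputable section

variable {X Y : Type*} [MeasurableSpace X] [MeasurableSpace Y]

/-- Law of `W_{t+1} = (X_{t+1}, Y_{t+1})` given the history `w^t`: the product of `P_X` and
`P_{Y'|Y}(· | y_t)`. -/
def stepKernel (PX : Measure X) [IsProbabilityMeasure PX] (PY : Kernel Y Y) [IsMarkovKernel PY]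
    (t : ℕ) : Kernel (History (X × Y) t) (X × Y) :=
  Kernel.const _ PX ×ₖ PY.comap (fun w => w.last.2) (measurable_last t).snd

instance instMarkovStepKernel (PX : Measure X) [IsProbabilityMeasure PX] (PY : Kernel Y Y)
    [IsMarkovKernel PY] (t : ℕ) : IsMarkovKernel (stepKernel PX PY t) := by
  unfold stepKernel; infer_instance

/-- Conditional law of the infinite history `W^∞` given `W^t = w^t`. -/
def pathLaw (PX : Measure X) [IsProbabilityMeasure PX] (PY : Kernel Y Y) [IsMarkovKernel PY]
    (t : ℕ) (w : History (X × Y) t) : Measure (ℕ → X × Y) :=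
  Kernel.traj (X := fun _ => X × Y) (stepKernel PX PY) t w

/-- Conditional likelihood ratios at the current state `y`: nonnegative `g` with
`E_Y[g(Y') | y] = 1`. -/
def likelihoodRatios (PY : Kernel Y Y) (y : Y) : Set (Y → ℝ) :=
  {g | (∀ y', 0 ≤ g y') ∧ ∫ y', g y' ∂(PY y) = 1}

/-- Conditional relative entropy `E_Y[g(Y') log g(Y') | y]` (with `0 log 0 = 0`). -/
def relEntropy (PY : Kernel Y Y) (g : Y → ℝ) (y : Y) : ℝ :=
  ∫ y', g y' * Real.log (g y') ∂(PY y)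

/-- Admissible sequences of conditional likelihood ratios. Here `m s w` stands for
`m_{s+1}(· | w^s)` with `w = w^s`. -/
structure IsDistortion (PY : Kernel Y Y) (m : (s : ℕ) → History (X × Y) s → Y → ℝ) : Prop where
  measurable : ∀ s, Measurable (fun p : History (X × Y) s × Y => m s p.1 p.2)
  mem : ∀ s w, m s w ∈ likelihoodRatios PY w.last.2

/-- The ratio `M_{t+j} / M_t = ∏_{τ=t+1}^{t+j} m_τ` along an infinite history. -/
def cumRatio (m : (s : ℕ) → History (X × Y) s → Y → ℝ) (t j : ℕ) (ω : ℕ → X × Y) : ℝ :=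
  ∏ i ∈ Finset.range j, m (t + i) (upTo (t + i) ω) (ω (t + i + 1)).2

/-- Expectation of an extended-real random variable: `E[f⁺] - E[f⁻]`. -/
def extExpect {Ω : Type*} [MeasurableSpace Ω] (μ : Measure Ω) (f : Ω → EReal) : EReal :=
  ((∫⁻ ω, (f ω).toENNReal ∂μ : ℝ≥0∞) : EReal) - ((∫⁻ ω, (-f ω).toENNReal ∂μ : ℝ≥0∞) : EReal)

/-- Period payoff `c_s(w^s) + θ γ ℰ[m_{s+1}(· | w^s)](y_s)`, with `∞ · 0 = 0` if `θ = ∞`. -/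
def payoff (PY : Kernel Y Y) (γ : ℝ) (θ : ℝ≥0∞) (c : (s : ℕ) → History (X × Y) s → ℝ)
    (m : (s : ℕ) → History (X × Y) s → Y → ℝ) (s : ℕ) (w : History (X × Y) s) : EReal :=
  (c s w : EReal) + (θ : EReal) * ((γ * relEntropy PY (m s w) w.last.2 : ℝ) : EReal)

/-- The objective of the sequential problem at the history `w^t`,
`∑_{j ≥ 0} γ^j E[(M_{t+j} / M_t) (c_{t+j} + θ γ ℰ[m_{t+j+1}](Y_{t+j})) | w^t]`.
For bounded `c` the partial sums converge in `(-∞, ∞]`, so `limsup` is their limit. -/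
def seqObjective (PX : Measure X) [IsProbabilityMeasure PX] (PY : Kernel Y Y) [IsMarkovKernel PY]
    (γ : ℝ) (θ : ℝ≥0∞) (c : (s : ℕ) → History (X × Y) s → ℝ)
    (m : (s : ℕ) → History (X × Y) s → Y → ℝ) (t : ℕ) (w : History (X × Y) t) : EReal :=
  limsup (fun n : ℕ => ∑ j ∈ Finset.range n, ((γ ^ j : ℝ) : EReal) *
    extExpect (pathLaw PX PY t w) (fun ω =>
      (cumRatio m t j ω : EReal) * payoff PY γ θ c m (t + j) (upTo (t + j) ω))) atTop

/-- `v` is the (attained) minimum of the sequential problem at the history `w^t`. -/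
def IsSeqValue (PX : Measure X) [IsProbabilityMeasure PX] (PY : Kernel Y Y) [IsMarkovKernel PY]
    (γ : ℝ) (θ : ℝ≥0∞) (c : (s : ℕ) → History (X × Y) s → ℝ)
    (t : ℕ) (w : History (X × Y) t) (v : ℝ) : Prop :=
  IsLeast {a : EReal | ∃ m, IsDistortion PY m ∧ a = seqObjective PX PY γ θ c m t w} (v : EReal)

/-- `U` satisfies the sequential problem of the minimizing agent. -/
def SatisfiesSP (PX : Measure X) [IsProbabilityMeasure PX] (PY : Kernel Y Y) [IsMarkovKernel PY]
    (γ : ℝ) (θ : ℝ≥0∞) (c U : (s : ℕ) → History (X × Y) s → ℝ) : Prop :=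
  ∀ t w, IsSeqValue PX PY γ θ c t w (U t w)

/-- The continuation utility `E_X[U_{t+1}(w^t, X_{t+1}, y')]`. -/
def contUtility (PX : Measure X) (U : (s : ℕ) → History (X × Y) s → ℝ)
    (t : ℕ) (w : History (X × Y) t) (y' : Y) : ℝ :=
  ∫ x, U (t + 1) (w.snoc (x, y')) ∂PX

/-- `U` satisfies the functional problem of the minimizing agent: the expectations in the
equation make sense, and `U_t(w^t) = c_t(w^t) + γ min_g {E_Y[g 𝒰_{t+1}(w^t, ·) | y_t] + θ ℰ[g](y_t)}`
at every history, where the minimum is attained. -/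
structure SatisfiesFP (PX : Measure X) (PY : Kernel Y Y)
    (γ : ℝ) (θ : ℝ≥0∞) (c U : (s : ℕ) → History (X × Y) s → ℝ) : Prop where
  measurable : ∀ t, Measurable (U t)
  integrable : ∀ t (w : History (X × Y) t) (y' : Y),
    Integrable (fun x => U (t + 1) (w.snoc (x, y'))) PX
  bellman : ∀ t (w : History (X × Y) t), ∃ v : ℝ,
    IsLeast {a : EReal | ∃ g ∈ likelihoodRatios PY w.last.2,
      a = ((∫ y', g y' * contUtility PX U t w y' ∂(PY w.last.2) : ℝ) : EReal)
        + (θ : EReal) * (relEntropy PY g w.last.2 : EReal)} (v : EReal) ∧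
    U t w = c t w + γ * v

/-- The transversality condition given `w^t`: for every admissible distortion the expectations
`E[(M_{t+T+1} / M_t) U_{t+T+1}(W^{t+T+1}) | w^t]` exist and, multiplied by `γ^{T+1}`, tend to 0.
For `t = 0` this is the condition `γ^{T+1} E[M_{T+1} U_{T+1}(W^{T+1}) | w_0] → 0`. -/
def Transversality (PX : Measure X) [IsProbabilityMeasure PX] (PY : Kernel Y Y)
    [IsMarkovKernel PY] (γ : ℝ) (U : (s : ℕ) → History (X × Y) s → ℝ)
    (t : ℕ) (w : History (X × Y) t) : Prop :=
  ∀ m, IsDistortion PY m →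
    (∀ T : ℕ, Integrable
      (fun ω => cumRatio m t (T + 1) ω * U (t + (T + 1)) (upTo (t + (T + 1)) ω))
      (pathLaw PX PY t w)) ∧
    Tendsto (fun T : ℕ => γ ^ (T + 1) *
      ∫ ω, cumRatio m t (T + 1) ω * U (t + (T + 1)) (upTo (t + (T + 1)) ω) ∂(pathLaw PX PY t w))
      atTop (𝓝 0)

end

end MinAgent

/-! The one-period problem has a closed form (Gibbs variational principle): `min_g {E[g u] + θ E[g
log g]}` equals `-θ log E[exp(-u/θ)]`, attained at the density proportional to `exp(-u/θ)`. For `θ =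
∞` the penalty forces `g = 1` almost surely and the minimum is `E[u]`. FP-MA is therefore the
recursion `U_s = c_s + γ * robustMin (...)`, whose minimizer is an explicit, hence measurable,
function of the history.

Part (b) is a verification argument. For any distortion, `U_s` minus the discounted distorted
expectation of `U_{s+1}` is at most the period payoff, with equality for the Gibbs density
(`netUtility_le_payoff`, `netUtility_eq_payoff`). Weighted by `γ^j M_{t+j}/M_t` and integrated, the
left sides telescope to `U_t - γ^n E[(M_{t+n}/M_t) U_{t+n}]` (`integral_netUtility`), and
transversality removes the remainder.

Part (a) needs no dynamic programming principle. Since `c` is bounded, FP-MA has a bounded solution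
`V` (`exists_bounded_satisfiesFP`). Bounded functions satisfy transversality, so by (b) `V` is the
sequential value everywhere. Minima are unique, so any solution of SP-MA equals `V`. -/

namespace MinAgent

noncomputable section

/-! ### The one-period entropy-penalized minimum -/

section Gibbs

variable {Y : Type*} [MeasurableSpace Y]

/-- Value of `min_g {E[g u] + θ E[g log g]}` over likelihood ratios `g`. -/
def robustMin (P : Measure Y) (θ : ℝ≥0∞) (u : Y → ℝ) : ℝ :=
  if θ = ∞ then ∫ y, u y ∂P
  else -θ.toReal * Real.log (∫ y, Real.exp (-u y / θ.toReal) ∂P)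

/-- The likelihood ratio attaining `min_g {E[g u] + θ E[g log g]}`. -/
def worstRatio (P : Measure Y) (θ : ℝ≥0∞) (u : Y → ℝ) (y' : Y) : ℝ :=
  if θ = ∞ then 1
  else Real.exp (-u y' / θ.toReal) / ∫ y, Real.exp (-u y / θ.toReal) ∂P

lemma integral_mul_neg_div {P : Measure Y} (g u : Y → ℝ) (r : ℝ) :
    ∫ y', g y' * (-u y' / r) ∂P = -(∫ y', g y' * u y' ∂P) / r := by
  rw [← integral_neg, ← integral_div]
  congr with y'
  ring

lemma robustMin_const (P : Measure Y) [IsProbabilityMeasure P] {θ : ℝ≥0∞} (hθ : 0 < θ) (k : ℝ) :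
    robustMin P θ (fun _ => k) = k := by
  unfold robustMin
  split_ifs with h
  · simp
  · have hr : 0 < θ.toReal := ENNReal.toReal_pos hθ.ne' h
    simp only [integral_const, probReal_univ, one_smul, Real.log_exp]
    field_simp

variable [Finite Y] [MeasurableSingletonClass Y]

lemma integral_exp_pos_of_finite (P : Measure Y) [IsProbabilityMeasure P] (u : Y → ℝ) :
    0 < ∫ y, Real.exp (u y) ∂P :=
  integral_exp_pos Integrable.of_finite

variable {PY : Kernel Y Y} [IsMarkovKernel PY] {y : Y}

lemma worstRatio_mem (θ : ℝ≥0∞) (u : Y → ℝ) :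
    worstRatio (PY y) θ u ∈ likelihoodRatios PY y := by
  have hZ := integral_exp_pos_of_finite (PY y) (fun y' => -u y' / θ.toReal)
  by_cases h : θ = ∞
  · simp [likelihoodRatios, worstRatio, h]
  · refine ⟨fun y' => ?_, ?_⟩
    · simp only [worstRatio, h, if_false]
      positivity
    · simp only [worstRatio, h, if_false]
      rw [integral_div, div_self hZ.ne']

/-- `klFun x = x log x + 1 - x`, and the correction `1 - g` has mean zero. The integrand becomes
pointwise nonnegative and vanishes only at `g = 1`, which yields both the sign of the entropy and
its equality case. -/
lemma integral_klFun_eq_relEntropy {g : Y → ℝ} (hg : g ∈ likelihoodRatios PY y) :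
    ∫ y', InformationTheory.klFun (g y') ∂(PY y) = relEntropy PY g y := by
  simp only [InformationTheory.klFun_apply, relEntropy]
  rw [integral_sub Integrable.of_finite Integrable.of_finite,
    integral_add Integrable.of_finite Integrable.of_finite, hg.2]
  simp

lemma relEntropy_nonneg {g : Y → ℝ} (hg : g ∈ likelihoodRatios PY y) :
    0 ≤ relEntropy PY g y := by
  rw [← integral_klFun_eq_relEntropy hg]
  exact integral_nonneg fun y' => InformationTheory.klFun_nonneg (hg.1 y')

lemma ae_eq_one_of_relEntropy_eq_zero {g : Y → ℝ} (hg : g ∈ likelihoodRatios PY y)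
    (h0 : relEntropy PY g y = 0) : ∀ᵐ y' ∂(PY y), g y' = 1 := by
  rw [← integral_klFun_eq_relEntropy hg, integral_eq_zero_iff_of_nonneg
    (fun y' => InformationTheory.klFun_nonneg (hg.1 y')) Integrable.of_finite] at h0
  filter_upwards [h0] with y' hy'
  exact (InformationTheory.klFun_eq_zero_iff (hg.1 y')).1 hy'

/-- The variational inequality of Gibbs, for finite `θ`. -/
lemma neg_log_integral_exp_le {g : Y → ℝ} (hg : g ∈ likelihoodRatios PY y) (a : Y → ℝ) :
    ∫ y', g y' * a y' ∂(PY y) - Real.log (∫ y', Real.exp (a y') ∂(PY y)) ≤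
      relEntropy PY g y := by
  set Z := ∫ y', Real.exp (a y') ∂(PY y) with hZdef
  have hZ : 0 < Z := integral_exp_pos_of_finite (PY y) a
  -- With `k = exp a / Z`, the density of the tilted law, this expression is `k * klFun (g / k)`.
  -- The case `g y' = 0` is separate because there the logarithm of the quotient does not split.
  have key : ∀ y', 0 ≤ g y' * Real.log (g y') - g y' * a y' + g y' * Real.log Z
      + Real.exp (a y') / Z - g y' := by
    intro y'
    have hk : 0 < Real.exp (a y') / Z := by positivity
    have h := InformationTheory.klFun_nonneg (div_nonneg (hg.1 y') hk.le)
    rcases (hg.1 y').eq_or_lt with h0 | hpos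
    · simp [← h0, hk.le]
    · rw [InformationTheory.klFun_apply, Real.log_div hpos.ne' hk.ne',
        Real.log_div (Real.exp_pos _).ne' hZ.ne', Real.log_exp] at h
      have h2 := mul_nonneg hk.le h
      have h3 : Real.exp (a y') / Z * (g y' / (Real.exp (a y') / Z)) = g y' :=
        mul_div_cancel₀ _ hk.ne'
      calc (0 : ℝ) ≤ _ := h2
        _ = Real.exp (a y') / Z * (g y' / (Real.exp (a y') / Z)) *
              (Real.log (g y') - (a y' - Real.log Z)) + Real.exp (a y') / Z
              - Real.exp (a y') / Z * (g y' / (Real.exp (a y') / Z)) := by ring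
        _ = _ := by rw [h3]; ring
  have hint := integral_nonneg (μ := PY y) (f := fun y' => g y' * Real.log (g y') - g y' * a y' +
    g y' * Real.log Z + Real.exp (a y') / Z - g y') key
  rw [integral_sub Integrable.of_finite Integrable.of_finite,
    integral_add Integrable.of_finite Integrable.of_finite,
    integral_add Integrable.of_finite Integrable.of_finite,
    integral_sub Integrable.of_finite Integrable.of_finite, integral_div, ← hZdef,
    div_self hZ.ne', integral_mul_const, hg.2] at hint
  simp only [relEntropy]
  linarith

/-- The logarithm of the tilted density is `a - log Z`: the equality case of the Gibbs inequality.
-/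
lemma relEntropy_exp_div (a : Y → ℝ) :
    relEntropy PY (fun y' => Real.exp (a y') / ∫ z, Real.exp (a z) ∂(PY y)) y =
      ∫ y', Real.exp (a y') / (∫ z, Real.exp (a z) ∂(PY y)) * a y' ∂(PY y)
        - Real.log (∫ y', Real.exp (a y') ∂(PY y)) := by
  set Z := ∫ y', Real.exp (a y') ∂(PY y) with hZdef
  have hZ : 0 < Z := integral_exp_pos_of_finite (PY y) a
  have : ∀ y', Real.exp (a y') / Z * Real.log (Real.exp (a y') / Z) =
      Real.exp (a y') / Z * a y' - Real.exp (a y') / Z * Real.log Z := fun y' => by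
    rw [Real.log_div (Real.exp_pos _).ne' hZ.ne', Real.log_exp]; ring
  simp only [relEntropy, this]
  rw [integral_sub Integrable.of_finite Integrable.of_finite, integral_mul_const, integral_div,
    ← hZdef, div_self hZ.ne', one_mul]

/-- `robustMin` is a lower bound of the penalized expectations. -/
lemma robustMin_sub_le {θ : ℝ≥0∞} (hθ : 0 < θ) (u : Y → ℝ) {g : Y → ℝ}
    (hg : g ∈ likelihoodRatios PY y) :
    ((robustMin (PY y) θ u - ∫ y', g y' * u y' ∂(PY y) : ℝ) : EReal) ≤
      (θ : EReal) * (relEntropy PY g y : EReal) := by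
  by_cases h : θ = ∞
  · subst h
    -- Zero entropy forces `g = 1` almost everywhere; positive entropy makes the penalty `⊤`.
    rcases (relEntropy_nonneg hg).eq_or_lt with h0 | hpos
    · have : ∫ y', g y' * u y' ∂(PY y) = ∫ y', u y' ∂(PY y) := by
        refine integral_congr_ae ?_
        filter_upwards [ae_eq_one_of_relEntropy_eq_zero hg h0.symm] with y' hy'
        rw [hy', one_mul]
      simp [robustMin, this, ← h0]
    · rw [EReal.coe_ennreal_top, EReal.top_mul_coe_of_pos hpos]
      exact le_top
  · have hr : 0 < θ.toReal := ENNReal.toReal_pos hθ.ne' h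
    have key := neg_log_integral_exp_le hg (fun y' => -u y' / θ.toReal)
    rw [integral_mul_neg_div] at key
    have key2 := mul_le_mul_of_nonneg_left key hr.le
    rw [mul_sub, mul_div_cancel₀ _ hr.ne'] at key2
    rw [← EReal.coe_ennreal_toReal h, ← EReal.coe_mul, EReal.coe_le_coe_iff]
    simp only [robustMin, h, if_false]
    linarith

/-- `robustMin` is attained at `worstRatio`. -/
lemma robustMin_sub_eq {θ : ℝ≥0∞} (hθ : 0 < θ) (u : Y → ℝ) :
    (θ : EReal) * (relEntropy PY (worstRatio (PY y) θ u) y : EReal) =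
      ((robustMin (PY y) θ u - ∫ y', worstRatio (PY y) θ u y' * u y' ∂(PY y) : ℝ) : EReal) := by
  by_cases h : θ = ∞
  · simp [robustMin, worstRatio, relEntropy, h]
  · have hr : 0 < θ.toReal := ENNReal.toReal_pos hθ.ne' h
    have key := relEntropy_exp_div (PY := PY) (y := y) (fun y' => -u y' / θ.toReal)
    rw [integral_mul_neg_div] at key
    have hw : worstRatio (PY y) θ u = fun y' => Real.exp (-u y' / θ.toReal) /
        ∫ z, Real.exp (-u z / θ.toReal) ∂(PY y) := by
      funext y'
      simp [worstRatio, h]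
    rw [← EReal.coe_ennreal_toReal h, ← EReal.coe_mul, EReal.coe_eq_coe_iff, hw, key,
      mul_sub, mul_div_cancel₀ _ hr.ne']
    simp only [robustMin, h, if_false]
    ring

lemma isLeast_robustMin {θ : ℝ≥0∞} (hθ : 0 < θ) (u : Y → ℝ) :
    IsLeast {a : EReal | ∃ g ∈ likelihoodRatios PY y,
      a = ((∫ y', g y' * u y' ∂(PY y) : ℝ) : EReal) + (θ : EReal) * (relEntropy PY g y : EReal)}
      (robustMin (PY y) θ u : EReal) := by
  refine ⟨⟨_, worstRatio_mem θ u, ?_⟩, ?_⟩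
  · rw [robustMin_sub_eq hθ, ← EReal.coe_add, add_sub_cancel]
  · rintro _ ⟨g, hg, rfl⟩
    refine le_trans (le_of_eq ?_) (add_le_add_right (robustMin_sub_le hθ u hg) _)
    rw [← EReal.coe_add, add_sub_cancel]

lemma robustMin_mono (P : Measure Y) [IsProbabilityMeasure P] {θ : ℝ≥0∞} {u v : Y → ℝ}
    (h : u ≤ v) : robustMin P θ u ≤ robustMin P θ v := by
  unfold robustMin
  split_ifs
  · exact integral_mono Integrable.of_finite Integrable.of_finite h
  · have hle : ∫ y, Real.exp (-v y / θ.toReal) ∂P ≤ ∫ y, Real.exp (-u y / θ.toReal) ∂P := by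
      refine integral_mono Integrable.of_finite Integrable.of_finite fun y => ?_
      have := h y
      dsimp only
      gcongr
    have := mul_le_mul_of_nonneg_left (Real.log_le_log (integral_exp_pos_of_finite P _) hle)
      (ENNReal.toReal_nonneg (a := θ))
    linarith

lemma tendsto_integral_of_finite (P : Measure Y) [IsFiniteMeasure P] {u : ℕ → Y → ℝ} {v : Y → ℝ}
    (h : ∀ y, Tendsto (fun n => u n y) atTop (𝓝 (v y))) :
    Tendsto (fun n => ∫ y, u n y ∂P) atTop (𝓝 (∫ y, v y ∂P)) := by
  have := Fintype.ofFinite Y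
  simp only [integral_fintype Integrable.of_finite]
  exact tendsto_finsetSum _ fun y _ => (h y).const_smul _

lemma tendsto_robustMin (P : Measure Y) [IsProbabilityMeasure P] (θ : ℝ≥0∞) {u : ℕ → Y → ℝ}
    {v : Y → ℝ} (h : ∀ y, Tendsto (fun n => u n y) atTop (𝓝 (v y))) :
    Tendsto (fun n => robustMin P θ (u n)) atTop (𝓝 (robustMin P θ v)) := by
  unfold robustMin
  split_ifs
  · exact tendsto_integral_of_finite P h
  · refine ((tendsto_integral_of_finite P fun y => ?_).log
      (integral_exp_pos_of_finite P _).ne').const_mul _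
    exact (Real.continuous_exp.tendsto _).comp ((h y).neg.div_const _)

end Gibbs

/-! ### Extended-real expectations -/

section ExtExpect

variable {Ω : Type*} [MeasurableSpace Ω]

/-- Both lower integrals are monotone without measurability or integrability, so payoffs can be
compared even where they are infinite. -/
lemma extExpect_mono (μ : Measure Ω) {f g : Ω → EReal} (h : ∀ ω, f ω ≤ g ω) :
    extExpect μ f ≤ extExpect μ g := by
  refine EReal.sub_le_sub ?_ ?_
  · exact EReal.coe_ennreal_le_coe_ennreal_iff.2
      (lintegral_mono fun ω => EReal.toENNReal_le_toENNReal (h ω))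
  · exact EReal.coe_ennreal_le_coe_ennreal_iff.2
      (lintegral_mono fun ω => EReal.toENNReal_le_toENNReal (EReal.neg_le_neg_iff.2 (h ω)))

lemma extExpect_coe {μ : Measure Ω} {f : Ω → ℝ} (hf : Integrable f μ) :
    extExpect μ (fun ω => (f ω : EReal)) = ((∫ ω, f ω ∂μ : ℝ) : EReal) := by
  have h1 : ∫⁻ ω, ENNReal.ofReal (f ω) ∂μ ≠ ∞ := hf.lintegral_lt_top.ne
  have h2 : ∫⁻ ω, ENNReal.ofReal (-f ω) ∂μ ≠ ∞ := hf.neg.lintegral_lt_top.ne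
  rw [integral_eq_lintegral_pos_part_sub_lintegral_neg_part hf, EReal.coe_sub,
    EReal.coe_ennreal_toReal h1, EReal.coe_ennreal_toReal h2]
  simp only [extExpect, ← EReal.coe_neg, EReal.toENNReal_of_ne_top (EReal.coe_ne_top _),
    EReal.toReal_coe]

end ExtExpect

/-! ### Restricting and extending histories -/

section Histories

variable {W : Type*}

/-- An infinite history continuing `w^t`. -/
def History.extend {t : ℕ} (w : History W t) : ℕ → W :=
  fun i => if h : i ≤ t then w ⟨i, Finset.mem_Iic.2 h⟩ else w.last

lemma History.extend_of_le {t i : ℕ} (w : History W t) (h : i ≤ t) :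
    w.extend i = w ⟨i, Finset.mem_Iic.2 h⟩ := dif_pos h

lemma upTo_extend_upTo {t s : ℕ} (h : s ≤ t) (ω : ℕ → W) :
    upTo s (upTo t ω).extend = upTo s ω := by
  funext ⟨i, hi⟩
  exact History.extend_of_le _ ((Finset.mem_Iic.1 hi).trans h)

lemma upTo_succ (t : ℕ) (ω : ℕ → W) : upTo (t + 1) ω = (upTo t ω).snoc (ω (t + 1)) := by
  funext ⟨i, hi⟩
  by_cases h : i ≤ t
  · simp [upTo, History.snoc, h]
  · have : i = t + 1 := by have := Finset.mem_Iic.1 hi; omega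
    subst this
    simp [upTo, History.snoc]

variable [MeasurableSpace W]

lemma measurable_upTo (t : ℕ) : Measurable (upTo t : (ℕ → W) → History W t) :=
  measurable_pi_lambda _ fun i => measurable_pi_apply i.1

lemma History.measurable_extend (t : ℕ) : Measurable (History.extend : History W t → ℕ → W) := by
  refine measurable_pi_lambda _ fun i => ?_
  by_cases h : i ≤ t
  · simp only [History.extend, h, dif_pos]
    exact measurable_pi_apply _
  · simp only [History.extend, h]
    exact measurable_last t

lemma History.measurable_snoc (t : ℕ) :
    Measurable (fun p : History W t × W => p.1.snoc p.2) := by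
  refine measurable_pi_lambda _ fun i => ?_
  by_cases h : i.1 ≤ t
  · simp only [History.snoc, h, dif_pos]
    exact (measurable_pi_apply _).comp measurable_fst
  · simp only [History.snoc, h]
    exact measurable_snd

end Histories

/-! ### One-step disintegration of the path law -/

section Paths

variable {X Y : Type*} [MeasurableSpace X] [MeasurableSpace Y]
  {PX : Measure X} [IsProbabilityMeasure PX] {PY : Kernel Y Y} [IsMarkovKernel PY]

instance isProbabilityMeasure_pathLaw (t : ℕ) (w : History (X × Y) t) :
    IsProbabilityMeasure (pathLaw PX PY t w) := by
  unfold pathLaw; infer_instance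

lemma stepKernel_apply {t : ℕ} (w : History (X × Y) t) :
    stepKernel PX PY t w = PX.prod (PY w.last.2) := by
  rw [stepKernel, Kernel.prod_apply, Kernel.const_apply, Kernel.comap_apply]

lemma map_upTo_pathLaw {t s : ℕ} (w : History (X × Y) t) :
    (pathLaw PX PY t w).map (upTo s) =
      Kernel.partialTraj (X := fun _ => X × Y) (stepKernel PX PY) t s w :=
  Kernel.traj_map_frestrictLe_apply (X := fun _ => X × Y) (κ := stepKernel PX PY) t s w

lemma integral_upTo_self {t : ℕ} (w : History (X × Y) t) {f : History (X × Y) t → ℝ}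
    (hf : Measurable f) : ∫ ω, f (upTo t ω) ∂(pathLaw PX PY t w) = f w := by
  rw [← integral_map (measurable_upTo t).aemeasurable hf.aestronglyMeasurable, map_upTo_pathLaw,
    Kernel.partialTraj_self, Kernel.id_apply, integral_dirac' _ _ hf.stronglyMeasurable]

/-- The Markov structure of the Ionescu-Tulcea measure; every conditioning on `W^s` below rests on
it. -/
lemma map_upTo_step_pathLaw {t s : ℕ} (hts : t ≤ s) (w : History (X × Y) t) :
    (pathLaw PX PY t w).map (fun ω => (upTo s ω, ω (s + 1))) =
      ((pathLaw PX PY t w).map (upTo s)) ⊗ₘ (stepKernel PX PY s) := by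
  rw [map_upTo_pathLaw]
  exact (Kernel.partialTraj_compProd_eq_map_traj (X := fun _ => X × Y)
    (κ := stepKernel PX PY) hts).symm

lemma measurable_upTo_step (s : ℕ) :
    Measurable (fun ω : ℕ → X × Y => (upTo s ω, ω (s + 1))) :=
  (measurable_upTo s).prodMk (measurable_pi_apply _)

lemma lintegral_pathLaw_step {t s : ℕ} (hts : t ≤ s) (w : History (X × Y) t)
    {f : History (X × Y) s × (X × Y) → ℝ≥0∞} (hf : Measurable f) :
    ∫⁻ ω, f (upTo s ω, ω (s + 1)) ∂(pathLaw PX PY t w) =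
      ∫⁻ ω, ∫⁻ v, f (upTo s ω, v) ∂(stepKernel PX PY s (upTo s ω)) ∂(pathLaw PX PY t w) := by
  rw [← lintegral_map hf (measurable_upTo_step s), map_upTo_step_pathLaw hts,
    Measure.lintegral_compProd hf, lintegral_map (hf.lintegral_kernel_prod_right') (measurable_upTo s)]

lemma integrable_pathLaw_step {t s : ℕ} (hts : t ≤ s) (w : History (X × Y) t)
    {f : History (X × Y) s × (X × Y) → ℝ} (hf : Measurable f)
    (hint : Integrable (fun ω => f (upTo s ω, ω (s + 1))) (pathLaw PX PY t w)) :
    Integrable (fun ω => ∫ v, f (upTo s ω, v) ∂(stepKernel PX PY s (upTo s ω)))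
      (pathLaw PX PY t w) ∧
    ∫ ω, f (upTo s ω, ω (s + 1)) ∂(pathLaw PX PY t w) =
      ∫ ω, ∫ v, f (upTo s ω, v) ∂(stepKernel PX PY s (upTo s ω)) ∂(pathLaw PX PY t w) := by
  have h1 : Integrable f (((pathLaw PX PY t w).map (upTo s)) ⊗ₘ (stepKernel PX PY s)) := by
    rw [← map_upTo_step_pathLaw hts]
    exact (integrable_map_measure hf.aestronglyMeasurable
      (measurable_upTo_step s).aemeasurable).2 hint
  have := Measure.isProbabilityMeasure_map (μ := pathLaw PX PY t w)
    (measurable_upTo (W := X × Y) s).aemeasurable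
  have h2 : Integrable (fun h => ∫ v, f (h, v) ∂(stepKernel PX PY s h))
      ((pathLaw PX PY t w).map (upTo s)) := by
    simpa using Integrable.integral_compProd h1
  refine ⟨(integrable_map_measure h2.aestronglyMeasurable (measurable_upTo s).aemeasurable).1 h2,
    ?_⟩
  rw [← integral_map (measurable_upTo_step s).aemeasurable hf.aestronglyMeasurable,
    map_upTo_step_pathLaw hts, Measure.integral_compProd h1,
    integral_map (measurable_upTo s).aemeasurable h2.aestronglyMeasurable]

/-- Integrating over the next state: first over `X`, then over `Y`. -/
lemma integral_stepKernel [Finite Y] [MeasurableSingletonClass Y] {U : (s : ℕ) → History (X × Y) s → ℝ}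
    {s : ℕ} (hU : Measurable (U (s + 1))) (h : History (X × Y) s)
    (hint : ∀ y', Integrable (fun x => U (s + 1) (h.snoc (x, y'))) PX) (g : Y → ℝ) :
    ∫ v, g v.2 * U (s + 1) (h.snoc v) ∂(stepKernel PX PY s h) =
      ∫ y', g y' * contUtility PX U s h y' ∂(PY h.last.2) := by
  have hm : Measurable (fun v : X × Y => g v.2 * U (s + 1) (h.snoc v)) :=
    ((measurable_of_finite g).comp measurable_snd).mul
      (hU.comp ((History.measurable_snoc s).comp measurable_prodMk_left))
  have hi : Integrable (fun v : X × Y => g v.2 * U (s + 1) (h.snoc v))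
      (PX.prod (PY h.last.2)) := by
    -- As `Y` is finite, integrability of each `X`-slice suffices for joint integrability.
    rw [integrable_prod_iff' hm.aestronglyMeasurable]
    exact ⟨.of_forall fun y' => (hint y').const_mul (g y'), Integrable.of_finite⟩
  rw [stepKernel_apply, integral_prod_symm _ hi]
  simp only [integral_const_mul, contUtility]

end Paths

/-! ### Cumulative likelihood ratios -/

section CumRatio

section Products

variable {X Y : Type*} {m : (s : ℕ) → History (X × Y) s → Y → ℝ}

lemma cumRatio_succ (t j : ℕ) (ω : ℕ → X × Y) : cumRatio m t (j + 1) ω =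
    cumRatio m t j ω * m (t + j) (upTo (t + j) ω) (ω (t + j + 1)).2 :=
  Finset.prod_range_succ _ _

/-- The product only reads coordinates up to `t + j`. Through `History.extend` it becomes a function
of the finite history, the form the one-step disintegration requires. -/
lemma cumRatio_extend (t j : ℕ) (ω : ℕ → X × Y) :
    cumRatio m t j (upTo (t + j) ω).extend = cumRatio m t j ω := by
  refine Finset.prod_congr rfl fun i hi => ?_
  have hi := Finset.mem_range.1 hi
  rw [upTo_extend_upTo (by omega), History.extend_of_le _ (by omega)]
  rfl

end Products

variable {X Y : Type*} [MeasurableSpace X] [MeasurableSpace Y] {PY : Kernel Y Y}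
  {m : (s : ℕ) → History (X × Y) s → Y → ℝ}

lemma cumRatio_nonneg (hm : IsDistortion PY m) (t j : ℕ) (ω : ℕ → X × Y) :
    0 ≤ cumRatio m t j ω :=
  Finset.prod_nonneg fun _ _ => (hm.mem _ _).1 _

lemma measurable_cumRatio (hm : IsDistortion PY m) (t j : ℕ) : Measurable (cumRatio m t j) := by
  refine Finset.measurable_prod _ fun i _ => ?_
  exact (hm.measurable (t + i)).comp
    ((measurable_upTo _).prodMk (measurable_snd.comp (measurable_pi_apply _)))

variable {PX : Measure X} [IsProbabilityMeasure PX] [IsMarkovKernel PY]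

/-- The ratio is a martingale, since each factor has conditional mean one. Working with `∫⁻` makes
the induction free of integrability conditions and then supplies integrability. -/
lemma lintegral_cumRatio [Finite Y] [MeasurableSingletonClass Y] (hm : IsDistortion PY m) (t j : ℕ)
    (w : History (X × Y) t) :
    ∫⁻ ω, ENNReal.ofReal (cumRatio m t j ω) ∂(pathLaw PX PY t w) = 1 := by
  induction j with
  | zero => simp [cumRatio]
  | succ j ih =>
    have hstep : ∀ h : History (X × Y) (t + j), ∫⁻ v, ENNReal.ofReal (m (t + j) h v.2)
        ∂(stepKernel PX PY (t + j) h) = 1 := fun h => by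
      have hmem := hm.mem (t + j) h
      rw [stepKernel_apply, lintegral_prod_symm' (fun v : X × Y => ENNReal.ofReal (m (t + j) h v.2))
        ((measurable_of_finite (m (t + j) h)).comp measurable_snd).ennreal_ofReal]
      simp only [lintegral_const, measure_univ, mul_one]
      rw [← ofReal_integral_eq_lintegral_ofReal Integrable.of_finite (.of_forall hmem.1), hmem.2,
        ENNReal.ofReal_one]
    have hms : Measurable fun p : History (X × Y) (t + j) × (X × Y) =>
        ENNReal.ofReal (cumRatio m t j p.1.extend) * ENNReal.ofReal (m (t + j) p.1 p.2.2) := by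
      have h1 : Measurable fun p : History (X × Y) (t + j) × (X × Y) =>
          cumRatio m t j p.1.extend := (measurable_cumRatio hm t j).comp
        ((History.measurable_extend (t + j)).comp measurable_fst)
      have h2 : Measurable fun p : History (X × Y) (t + j) × (X × Y) => m (t + j) p.1 p.2.2 :=
        (hm.measurable (t + j)).comp (measurable_fst.prodMk measurable_snd.snd)
      exact h1.ennreal_ofReal.mul h2.ennreal_ofReal
    have key := lintegral_pathLaw_step (PX := PX) (PY := PY) (Nat.le_add_right t j) w hms
    simp only [cumRatio_extend] at key
    simp only [cumRatio_succ, ENNReal.ofReal_mul (cumRatio_nonneg hm t j _)]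
    rw [key, ← ih]
    refine lintegral_congr fun ω => ?_
    rw [lintegral_const_mul, hstep, mul_one]
    exact ((hm.measurable (t + j)).comp
      (measurable_const.prodMk measurable_snd)).ennreal_ofReal

lemma integrable_cumRatio [Finite Y] [MeasurableSingletonClass Y] (hm : IsDistortion PY m) (t j : ℕ)
    (w : History (X × Y) t) : Integrable (cumRatio m t j) (pathLaw PX PY t w) := by
  refine ⟨(measurable_cumRatio hm t j).aestronglyMeasurable, ?_⟩
  rw [hasFiniteIntegral_iff_ofReal (.of_forall (cumRatio_nonneg hm t j)),
    lintegral_cumRatio hm]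
  exact ENNReal.one_lt_top

lemma integral_cumRatio [Finite Y] [MeasurableSingletonClass Y] (hm : IsDistortion PY m) (t j : ℕ)
    (w : History (X × Y) t) : ∫ ω, cumRatio m t j ω ∂(pathLaw PX PY t w) = 1 := by
  rw [integral_eq_lintegral_of_nonneg_ae (.of_forall (cumRatio_nonneg hm t j))
    (measurable_cumRatio hm t j).aestronglyMeasurable, lintegral_cumRatio hm, ENNReal.toReal_one]

/-- Bounded continuation values satisfy the transversality condition. -/
lemma transversality_of_bounded [Finite Y] [MeasurableSingletonClass Y] {γ : ℝ} (hγ0 : 0 < γ)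
    (hγ1 : γ < 1) {U : (s : ℕ) → History (X × Y) s → ℝ} (hU : ∀ s, Measurable (U s)) {K : ℝ}
    (hK : ∀ s w, |U s w| ≤ K) (t : ℕ) (w : History (X × Y) t) :
    Transversality PX PY γ U t w := by
  intro m hm
  have hbound : ∀ n ω, ‖cumRatio m t n ω * U (t + n) (upTo (t + n) ω)‖ ≤ cumRatio m t n ω * K := by
    intro n ω
    rw [norm_mul, Real.norm_of_nonneg (cumRatio_nonneg hm t n ω)]
    exact mul_le_mul_of_nonneg_left (hK _ _) (cumRatio_nonneg hm t n ω)
  refine ⟨fun T => ((integrable_cumRatio hm t (T + 1) w).mul_const K).mono'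
    ((measurable_cumRatio hm t _).mul ((hU _).comp (measurable_upTo _))).aestronglyMeasurable
    (.of_forall (hbound _)), ?_⟩
  have hlim : Tendsto (fun T : ℕ => γ ^ (T + 1) * K) atTop (𝓝 0) := by
    have := ((tendsto_pow_atTop_nhds_zero_of_lt_one hγ0.le hγ1).comp
      (tendsto_add_atTop_nat 1)).mul_const K
    simpa using this
  refine squeeze_zero_norm (fun T => ?_) hlim
  rw [norm_mul, Real.norm_of_nonneg (by positivity)]
  refine mul_le_mul_of_nonneg_left ?_ (by positivity)
  refine (norm_integral_le_of_norm_le ((integrable_cumRatio hm t (T + 1) w).mul_const K)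
    (.of_forall (hbound _))).trans_eq ?_
  rw [integral_mul_const, integral_cumRatio hm, one_mul]

end CumRatio

/-! ### Measurability of the value and of the minimizer -/

section Measurability

variable {X Y : Type*} [MeasurableSpace X] [MeasurableSpace Y] {PX : Measure X} [IsProbabilityMeasure PX]
  {PY : Kernel Y Y} [IsMarkovKernel PY] {U : (s : ℕ) → History (X × Y) s → ℝ}

lemma measurable_integral_nextState {s : ℕ} {F : History (X × Y) s → Y → ℝ}
    (hF : Measurable (Function.uncurry F)) :
    Measurable (fun h : History (X × Y) s => ∫ y', F h y' ∂(PY h.last.2)) :=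
  (StronglyMeasurable.integral_kernel_prod_right
    (κ := PY.comap (fun h : History (X × Y) s => h.last.2) (measurable_last s).snd)
    hF.stronglyMeasurable).measurable

lemma measurable_contUtility {s : ℕ} (hU : Measurable (U (s + 1))) :
    Measurable (Function.uncurry (contUtility PX U s)) := by
  have : Measurable (fun q : (History (X × Y) s × Y) × X => U (s + 1) (q.1.1.snoc (q.2, q.1.2))) :=
    hU.comp ((History.measurable_snoc s).comp
      (measurable_fst.fst.prodMk (measurable_snd.prodMk measurable_fst.snd)))
  exact (this.stronglyMeasurable.integral_prod_right' (ν := PX)).measurable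

lemma measurable_robustMin_contUtility (θ : ℝ≥0∞) {s : ℕ} (hU : Measurable (U (s + 1))) :
    Measurable (fun h : History (X × Y) s =>
      robustMin (PY h.last.2) θ (contUtility PX U s h)) := by
  have hm := measurable_contUtility (PX := PX) hU
  unfold robustMin
  split_ifs
  · exact measurable_integral_nextState hm
  · refine ((measurable_integral_nextState ?_).log).const_mul _
    exact (hm.neg.div_const _).exp

variable [Finite Y] [MeasurableSingletonClass Y]

/-- The explicit formula for the minimizer replaces a measurable selection argument. -/
lemma isDistortion_worstRatio (θ : ℝ≥0∞) (hU : ∀ s, Measurable (U s)) :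
    IsDistortion PY (fun (s : ℕ) (h : History (X × Y) s) =>
      worstRatio (PY h.last.2) θ (contUtility PX U s h)) := by
  refine ⟨fun s => ?_, fun s h => worstRatio_mem θ _⟩
  have hm := measurable_contUtility (PX := PX) (hU (s + 1))
  unfold worstRatio
  split_ifs
  · exact measurable_const
  · have hexp : Measurable (Function.uncurry fun (h : History (X × Y) s) (y' : Y) =>
        Real.exp (-contUtility PX U s h y' / θ.toReal)) := (hm.neg.div_const _).exp
    exact hexp.div ((measurable_integral_nextState (PY := PY) hexp).comp measurable_fst)

end Measurability

/-! ### Comparing net utility with the period payoff -/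

section Bellman

variable {X Y : Type*} [MeasurableSpace X] [MeasurableSpace Y] [Finite Y]
  [MeasurableSingletonClass Y] {PX : Measure X} {PY : Kernel Y Y} [IsMarkovKernel PY]
  {γ : ℝ} {θ : ℝ≥0∞} {c U : (s : ℕ) → History (X × Y) s → ℝ} {m : (s : ℕ) → History (X × Y) s → Y → ℝ}

lemma SatisfiesFP.eq_robustMin (hU : SatisfiesFP PX PY γ θ c U) (hθ : 0 < θ) (s : ℕ)
    (h : History (X × Y) s) :
    U s h = c s h + γ * robustMin (PY h.last.2) θ (contUtility PX U s h) := by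
  obtain ⟨v, hv, hUv⟩ := hU.bellman s h
  rw [hUv, EReal.coe_injective (hv.unique (isLeast_robustMin hθ _))]

/-- The part of `U_s` not carried over to the next period under the distortion `m`. -/
def netUtility (PX : Measure X) (PY : Kernel Y Y) (γ : ℝ) (U : (s : ℕ) → History (X × Y) s → ℝ)
    (m : (s : ℕ) → History (X × Y) s → Y → ℝ) (s : ℕ) (h : History (X × Y) s) : ℝ :=
  U s h - γ * ∫ y', m s h y' * contUtility PX U s h y' ∂(PY h.last.2)

lemma SatisfiesFP.netUtility_le_payoff (hU : SatisfiesFP PX PY γ θ c U) (hγ : 0 < γ) (hθ : 0 < θ)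
    (hm : IsDistortion PY m) (s : ℕ) (h : History (X × Y) s) :
    (netUtility PX PY γ U m s h : EReal) ≤ payoff PY γ θ c m s h := by
  rw [netUtility, hU.eq_robustMin hθ, add_sub_assoc, ← mul_sub, payoff, EReal.coe_add,
    EReal.coe_mul, EReal.coe_mul, mul_left_comm]
  exact add_le_add_right (mul_le_mul_of_nonneg_left (robustMin_sub_le hθ _ (hm.mem s h))
    (EReal.coe_nonneg.2 hγ.le)) _

lemma SatisfiesFP.netUtility_eq_payoff (hU : SatisfiesFP PX PY γ θ c U) (hθ : 0 < θ) (s : ℕ)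
    (h : History (X × Y) s) (hms : m s h = worstRatio (PY h.last.2) θ (contUtility PX U s h)) :
    payoff PY γ θ c m s h = (netUtility PX PY γ U m s h : EReal) := by
  rw [netUtility, hU.eq_robustMin hθ, add_sub_assoc, ← mul_sub, payoff, EReal.coe_add,
    EReal.coe_mul, EReal.coe_mul, mul_left_comm, hms, robustMin_sub_eq hθ]

end Bellman

/-! ### Telescoping and verification -/

section Verification

variable {X Y : Type*} [MeasurableSpace X] [MeasurableSpace Y] {PX : Measure X} [IsProbabilityMeasure PX]
  {PY : Kernel Y Y} [IsMarkovKernel PY] {γ : ℝ} {θ : ℝ≥0∞}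
  {c U : (s : ℕ) → History (X × Y) s → ℝ} {m : (s : ℕ) → History (X × Y) s → Y → ℝ}

/-- Transversality covers only indices `n ≥ 1`; at `n = 0` the law of `W^t` is the Dirac mass at
`w`. -/
lemma Transversality.integrable {t : ℕ} {w : History (X × Y) t}
    (htr : Transversality PX PY γ U t w) (hU : ∀ s, Measurable (U s)) (hm : IsDistortion PY m)
    (n : ℕ) : Integrable (fun ω => cumRatio m t n ω * U (t + n) (upTo (t + n) ω))
      (pathLaw PX PY t w) := by
  cases n with
  | succ n => exact (htr m hm).1 n
  | zero =>
    have h1 : Integrable (U t) ((pathLaw PX PY t w).map (upTo t)) := by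
      rw [map_upTo_pathLaw, Kernel.partialTraj_self, Kernel.id_apply]
      exact integrable_dirac' (hU t).stronglyMeasurable (by simp)
    have h2 : Integrable (fun ω => U t (upTo t ω)) (pathLaw PX PY t w) :=
      h1.comp_measurable (measurable_upTo t)
    simpa [cumRatio] using h2

/-- Partial sums of the net utilities telescope to `U_t`. -/
lemma tendsto_sub_pow_mul {t : ℕ} {w : History (X × Y) t}
    (htr : Transversality PX PY γ U t w) (hm : IsDistortion PY m) :
    Tendsto (fun n : ℕ => ((U t w - γ ^ n *
      ∫ ω, cumRatio m t n ω * U (t + n) (upTo (t + n) ω) ∂(pathLaw PX PY t w) : ℝ) : EReal))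
      atTop (𝓝 (U t w : EReal)) := by
  rw [EReal.tendsto_coe]
  have h0 := (tendsto_add_atTop_iff_nat (f := fun n : ℕ => γ ^ n *
      ∫ ω, cumRatio m t n ω * U (t + n) (upTo (t + n) ω) ∂(pathLaw PX PY t w)) 1).1 (htr m hm).2
  simpa using h0.const_sub (U t w)

lemma integral_cumRatio_zero {t : ℕ} {w : History (X × Y) t} (hU : Measurable (U t)) :
    ∫ ω, cumRatio m t 0 ω * U (t + 0) (upTo (t + 0) ω) ∂(pathLaw PX PY t w) = U t w := by
  simpa [cumRatio] using integral_upTo_self w hU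

variable [Finite Y] [MeasurableSingletonClass Y]

/-- One telescoping step: by the tower property, the conditional mean of `M_{t+n+1} U_{t+n+1}` given
`W^{t+n}` is `M_{t+n}` times the integral subtracted in `netUtility`. -/
lemma SatisfiesFP.integral_netUtility (hU : SatisfiesFP PX PY γ θ c U) (hm : IsDistortion PY m)
    {t n : ℕ} {w : History (X × Y) t}
    (h0 : Integrable (fun ω => cumRatio m t n ω * U (t + n) (upTo (t + n) ω)) (pathLaw PX PY t w))
    (h1 : Integrable (fun ω => cumRatio m t (n + 1) ω * U (t + (n + 1)) (upTo (t + (n + 1)) ω))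
      (pathLaw PX PY t w)) :
    Integrable (fun ω => cumRatio m t n ω * netUtility PX PY γ U m (t + n) (upTo (t + n) ω))
      (pathLaw PX PY t w) ∧
    ∫ ω, cumRatio m t n ω * netUtility PX PY γ U m (t + n) (upTo (t + n) ω) ∂(pathLaw PX PY t w) =
      ∫ ω, cumRatio m t n ω * U (t + n) (upTo (t + n) ω) ∂(pathLaw PX PY t w) -
        γ * ∫ ω, cumRatio m t (n + 1) ω * U (t + (n + 1)) (upTo (t + (n + 1)) ω)
          ∂(pathLaw PX PY t w) := by
  set f : History (X × Y) (t + n) × (X × Y) → ℝ := fun p => cumRatio m t n p.1.extend *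
    (m (t + n) p.1 p.2.2 * U (t + n + 1) (p.1.snoc p.2)) with hf_def
  have hf : Measurable f := by
    refine Measurable.mul ?_ (Measurable.mul ?_ ?_)
    · exact (measurable_cumRatio hm t n).comp
        ((History.measurable_extend (t + n)).comp measurable_fst)
    · exact (hm.measurable (t + n)).comp (measurable_fst.prodMk measurable_snd.snd)
    · exact (hU.measurable _).comp (History.measurable_snoc _)
  have hfω : ∀ ω : ℕ → X × Y, f (upTo (t + n) ω, ω (t + n + 1)) =
      cumRatio m t (n + 1) ω * U (t + (n + 1)) (upTo (t + (n + 1)) ω) := by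
    intro ω
    -- `t + (n + 1)` and `t + n + 1` agree definitionally, which fixes the type of the history.
    change _ = _ * U (t + n + 1) (upTo (t + n + 1) ω)
    simp only [hf_def]
    rw [cumRatio_extend, cumRatio_succ, upTo_succ, mul_assoc]
  have hinner : ∀ ω : ℕ → X × Y,
      ∫ v, f (upTo (t + n) ω, v) ∂(stepKernel PX PY (t + n) (upTo (t + n) ω)) =
        cumRatio m t n ω * ∫ y', m (t + n) (upTo (t + n) ω) y' *
          contUtility PX U (t + n) (upTo (t + n) ω) y' ∂(PY (upTo (t + n) ω).last.2) := by
    intro ω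
    simp only [hf_def, cumRatio_extend]
    rw [integral_const_mul, integral_stepKernel (hU.measurable _) _ (hU.integrable _ _)]
  simp only [← hfω] at h1 ⊢
  obtain ⟨h2, h3⟩ := integrable_pathLaw_step (Nat.le_add_right t n) w hf h1
  simp only [hinner] at h2 h3
  have heq : ∀ ω : ℕ → X × Y, cumRatio m t n ω * netUtility PX PY γ U m (t + n) (upTo (t + n) ω) =
      cumRatio m t n ω * U (t + n) (upTo (t + n) ω) - γ * (cumRatio m t n ω *
        ∫ y', m (t + n) (upTo (t + n) ω) y' *
          contUtility PX U (t + n) (upTo (t + n) ω) y' ∂(PY (upTo (t + n) ω).last.2)) := by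
    intro ω
    rw [netUtility]
    ring
  simp only [heq]
  refine ⟨h0.sub (h2.const_mul γ), ?_⟩
  rw [integral_sub h0 (h2.const_mul γ), integral_const_mul, h3]

/-- The value of a solution of the functional problem bounds every objective from below. -/
lemma SatisfiesFP.le_seqObjective (hU : SatisfiesFP PX PY γ θ c U) (hγ : 0 < γ) (hθ : 0 < θ)
    {t : ℕ} {w : History (X × Y) t} (htr : Transversality PX PY γ U t w)
    (hm : IsDistortion PY m) : (U t w : EReal) ≤ seqObjective PX PY γ θ c m t w := by
  -- `U t w` becomes the limsup of the telescoped sums, so the comparison can be made at each `n`,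
  -- by induction.
  rw [← (tendsto_sub_pow_mul htr hm).limsup_eq]
  refine limsup_le_limsup (.of_forall fun n => ?_)
  induction n with
  | zero =>
    dsimp only
    rw [integral_cumRatio_zero (hU.measurable t)]
    simp
  | succ n ih =>
    obtain ⟨hi, heq⟩ := hU.integral_netUtility hm (htr.integrable hU.measurable hm n)
      (htr.integrable hU.measurable hm (n + 1))
    dsimp only at ih ⊢
    rw [Finset.sum_range_succ]
    refine le_trans (le_of_eq ?_) (add_le_add ih (mul_le_mul_of_nonneg_left
      (extExpect_mono (pathLaw PX PY t w) (f := fun ω => ((cumRatio m t n ω *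
        netUtility PX PY γ U m (t + n) (upTo (t + n) ω) : ℝ) : EReal)) fun ω => ?_) ?_))
    · rw [extExpect_coe hi, heq, ← EReal.coe_mul, ← EReal.coe_add, EReal.coe_eq_coe_iff]
      ring
    · rw [EReal.coe_mul]
      exact mul_le_mul_of_nonneg_left (hU.netUtility_le_payoff hγ hθ hm _ _)
        (EReal.coe_nonneg.2 (cumRatio_nonneg hm t n ω))
    · exact EReal.coe_nonneg.2 (by positivity)

/-- The value of a solution of the functional problem is attained by the worst distortion. -/
lemma SatisfiesFP.seqObjective_worstRatio (hU : SatisfiesFP PX PY γ θ c U) (hθ : 0 < θ)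
    {t : ℕ} {w : History (X × Y) t} (htr : Transversality PX PY γ U t w) :
    seqObjective PX PY γ θ c (fun (s : ℕ) (h : History (X × Y) s) =>
      worstRatio (PY h.last.2) θ (contUtility PX U s h)) t w = (U t w : EReal) := by
  have hm := isDistortion_worstRatio (PX := PX) (PY := PY) θ hU.measurable
  set m := fun (s : ℕ) (h : History (X × Y) s) =>
    worstRatio (PY h.last.2) θ (contUtility PX U s h) with hm_def
  rw [← (tendsto_sub_pow_mul htr hm).limsup_eq]
  refine congrArg (fun f => limsup f atTop) (funext fun n => ?_)
  induction n with
  | zero =>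
    rw [integral_cumRatio_zero (hU.measurable t)]
    simp
  | succ n ih =>
    obtain ⟨hi, heq⟩ := hU.integral_netUtility hm (htr.integrable hU.measurable hm n)
      (htr.integrable hU.measurable hm (n + 1))
    have hpay : ∀ ω : ℕ → X × Y, (cumRatio m t n ω : EReal) *
        payoff PY γ θ c m (t + n) (upTo (t + n) ω) = ((cumRatio m t n ω *
        netUtility PX PY γ U m (t + n) (upTo (t + n) ω) : ℝ) : EReal) := fun ω => by
      rw [hU.netUtility_eq_payoff hθ _ _ rfl, EReal.coe_mul]
    rw [Finset.sum_range_succ, ih]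
    simp only [hpay]
    rw [extExpect_coe hi, heq, ← EReal.coe_mul, ← EReal.coe_add, EReal.coe_eq_coe_iff]
    ring

theorem SatisfiesFP.isSeqValue (hU : SatisfiesFP PX PY γ θ c U) (hγ : 0 < γ) (hθ : 0 < θ)
    {t : ℕ} {w : History (X × Y) t} (htr : Transversality PX PY γ U t w) :
    IsSeqValue PX PY γ θ c t w (U t w) := by
  refine ⟨⟨_, isDistortion_worstRatio θ hU.measurable, (hU.seqObjective_worstRatio hθ htr).symm⟩,
    ?_⟩
  rintro _ ⟨m, hm, rfl⟩
  exact hU.le_seqObjective hγ hθ htr hm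

end Verification

/-! ### A bounded solution by monotone iteration -/

section FixedPoint

variable {X Y : Type*} [MeasurableSpace X] [MeasurableSpace Y] {PX : Measure X} [IsProbabilityMeasure PX]
  {PY : Kernel Y Y} [IsMarkovKernel PY] {γ : ℝ} {θ : ℝ≥0∞}
  {c : (s : ℕ) → History (X × Y) s → ℝ}

/-- The Bellman operator of the functional problem. -/
def bellmanOp (PX : Measure X) (PY : Kernel Y Y) (γ : ℝ) (θ : ℝ≥0∞)
    (c U : (s : ℕ) → History (X × Y) s → ℝ) (s : ℕ) (h : History (X × Y) s) : ℝ :=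
  c s h + γ * robustMin (PY h.last.2) θ (contUtility PX U s h)

lemma integrable_snoc_of_bounded {U : (s : ℕ) → History (X × Y) s → ℝ} {K : ℝ}
    (hU : ∀ s, Measurable (U s)) (hK : ∀ s h, |U s h| ≤ K) (s : ℕ) (h : History (X × Y) s)
    (y' : Y) : Integrable (fun x => U (s + 1) (h.snoc (x, y'))) PX := by
  refine Integrable.of_bound (C := K) ?_ (.of_forall fun x => hK _ _)
  exact ((hU _).comp ((History.measurable_snoc s).comp
    (measurable_const.prodMk (measurable_id.prodMk measurable_const)))).aestronglyMeasurable

variable [Finite Y] [MeasurableSingletonClass Y]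

lemma abs_robustMin_le (P : Measure Y) [IsProbabilityMeasure P] (hθ : 0 < θ) {u : Y → ℝ} {K : ℝ}
    (hu : ∀ y, |u y| ≤ K) : |robustMin P θ u| ≤ K := by
  rw [abs_le]
  constructor
  · rw [← robustMin_const P hθ (-K)]
    exact robustMin_mono P fun y => (abs_le.1 (hu y)).1
  · rw [← robustMin_const P hθ K]
    exact robustMin_mono P fun y => (abs_le.1 (hu y)).2

lemma abs_bellmanOp_le (hγ : 0 ≤ γ) (hθ : 0 < θ) {U : (s : ℕ) → History (X × Y) s → ℝ} {C K : ℝ}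
    (hc : ∀ s h, |c s h| ≤ C) (hK : ∀ s h, |U s h| ≤ K) (s : ℕ) (h : History (X × Y) s) :
    |bellmanOp PX PY γ θ c U s h| ≤ C + γ * K := by
  refine (abs_add_le _ _).trans (add_le_add (hc s h) ?_)
  rw [abs_mul, abs_of_nonneg hγ]
  refine mul_le_mul_of_nonneg_left (abs_robustMin_le _ hθ fun y' => ?_) hγ
  have := norm_integral_le_of_norm_le_const (μ := PX) (f := fun x => U (s + 1) (h.snoc (x, y')))
    (C := K) (.of_forall fun x => hK _ _)
  simpa [contUtility] using this

lemma bellmanOp_mono (hγ : 0 ≤ γ) {U V : (s : ℕ) → History (X × Y) s → ℝ} {K : ℝ}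
    (hU : ∀ s, Measurable (U s)) (hV : ∀ s, Measurable (V s)) (hUK : ∀ s h, |U s h| ≤ K)
    (hVK : ∀ s h, |V s h| ≤ K) (hUV : ∀ s h, U s h ≤ V s h) (s : ℕ) (h : History (X × Y) s) :
    bellmanOp PX PY γ θ c U s h ≤ bellmanOp PX PY γ θ c V s h := by
  refine add_le_add le_rfl (mul_le_mul_of_nonneg_left (robustMin_mono _ fun y' => ?_) hγ)
  exact integral_mono (integrable_snoc_of_bounded hU hUK s h y')
    (integrable_snoc_of_bounded hV hVK s h y') fun x => hUV _ _

lemma tendsto_bellmanOp {V : ℕ → (s : ℕ) → History (X × Y) s → ℝ}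
    {U : (s : ℕ) → History (X × Y) s → ℝ} {K : ℝ} (hV : ∀ n s, Measurable (V n s))
    (hK : ∀ n s h, |V n s h| ≤ K)
    (hlim : ∀ s h, Tendsto (fun n => V n s h) atTop (𝓝 (U s h))) (s : ℕ) (h : History (X × Y) s) :
    Tendsto (fun n => bellmanOp PX PY γ θ c (V n) s h) atTop
      (𝓝 (bellmanOp PX PY γ θ c U s h)) := by
  refine ((tendsto_robustMin _ θ fun y' => ?_).const_mul γ).const_add _
  refine tendsto_integral_of_dominated_convergence (fun _ => K) (fun n =>
    (integrable_snoc_of_bounded (hV n) (hK n) s h y').aestronglyMeasurable)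
    (integrable_const K) (fun n => .of_forall fun x => hK _ _ _) (.of_forall fun x => hlim _ _)

/-- The functional problem has a bounded solution. -/
theorem exists_bounded_satisfiesFP (hγ0 : 0 ≤ γ) (hγ1 : γ < 1) (hθ : 0 < θ)
    (hc : ∀ s, Measurable (c s)) {C : ℝ} (hC : ∀ s h, |c s h| ≤ C) :
    ∃ U, SatisfiesFP PX PY γ θ c U ∧ ∃ K : ℝ, ∀ s h, |U s h| ≤ K := by
  -- If there are no histories, `C` may be negative; `|C|` ensures `0 ≤ K`.
  have hC' : ∀ s h, |c s h| ≤ |C| := fun s h => (hC s h).trans (le_abs_self C)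
  -- `K` solves `|C| + γ * K = K`, so the Bellman operator preserves the bound `K`.
  set K := |C| / (1 - γ) with hKdef
  have h1γ : 0 < 1 - γ := sub_pos.2 hγ1
  have hK0 : 0 ≤ K := by positivity
  have hCK : |C| + γ * K = K := by rw [hKdef]; field_simp; ring
  -- Starting from the lowest admissible function `-K`, the iterates increase. Their pointwise limit
  -- is measurable, and it is a fixed point because the operator is continuous under bounded
  -- pointwise convergence.
  let V : ℕ → (s : ℕ) → History (X × Y) s → ℝ :=
    fun n => (bellmanOp PX PY γ θ c)^[n] (fun _ _ => -K)
  have hVs : ∀ n, V (n + 1) = bellmanOp PX PY γ θ c (V n) :=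
    fun n => Function.iterate_succ_apply' _ _ _
  have hVm : ∀ n s, Measurable (V n s) := fun n => by
    induction n with
    | zero => exact fun s => measurable_const
    | succ n ih =>
      intro s
      rw [hVs]
      exact (hc s).add ((measurable_robustMin_contUtility θ (ih (s + 1))).const_mul γ)
  have hVK : ∀ n s h, |V n s h| ≤ K := fun n => by
    induction n with
    | zero => exact fun s h => by simp [V, abs_of_nonneg hK0]
    | succ n ih =>
      intro s h
      rw [hVs, ← hCK]
      exact abs_bellmanOp_le hγ0 hθ hC' ih s h
  have hVmono : ∀ n s h, V n s h ≤ V (n + 1) s h := fun n => by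
    induction n with
    | zero => exact fun s h => (abs_le.1 (hVK 1 s h)).1
    | succ n ih =>
      intro s h
      rw [hVs, hVs (n + 1)]
      exact bellmanOp_mono hγ0 (hVm n) (hVm (n + 1)) (hVK n) (hVK (n + 1)) ih s h
  let U : (s : ℕ) → History (X × Y) s → ℝ := fun s h => ⨆ n, V n s h
  have hlim : ∀ s h, Tendsto (fun n => V n s h) atTop (𝓝 (U s h)) := fun s h =>
    tendsto_atTop_ciSup (monotone_nat_of_le_succ fun n => hVmono n s h)
      ⟨K, by rintro _ ⟨n, rfl⟩; exact (abs_le.1 (hVK n s h)).2⟩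
  have hUm : ∀ s, Measurable (U s) := fun s =>
    measurable_of_tendsto_metrizable (fun n => hVm n s) (tendsto_pi_nhds.2 (hlim s))
  have hUK : ∀ s h, |U s h| ≤ K := fun s h =>
    le_of_tendsto (hlim s h).abs (.of_forall fun n => hVK n s h)
  have hfix : ∀ s h, U s h = bellmanOp PX PY γ θ c U s h := fun s h => by
    refine tendsto_nhds_unique ((tendsto_add_atTop_iff_nat 1).2 (hlim s h)) ?_
    simp only [hVs]
    exact tendsto_bellmanOp hVm hVK hlim s h
  exact ⟨U, ⟨hUm, integrable_snoc_of_bounded hUm hUK,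
    fun s h => ⟨_, isLeast_robustMin hθ _, hfix s h⟩⟩, K, hUK⟩

end FixedPoint

end

end MinAgent

/-! ### The theorem -/

theorem theoremS1 {X Y : Type*} [MeasurableSpace X] [MeasurableSpace Y] [Finite Y]
    [MeasurableSingletonClass Y]
    (PX : Measure X) [IsProbabilityMeasure PX] (PY : Kernel Y Y) [IsMarkovKernel PY]
    (γ : ℝ) (hγ0 : 0 < γ) (hγ1 : γ < 1) (θ : ℝ≥0∞) (hθ : 0 < θ)
    (c : (s : ℕ) → MinAgent.History (X × Y) s → ℝ) (hc : ∀ s, Measurable (c s))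
    (hcb : ∃ C : ℝ, ∀ s w, |c s w| ≤ C) :
    -- (a)
    (∀ U : (s : ℕ) → MinAgent.History (X × Y) s → ℝ, (∀ s, Measurable (U s)) →
      MinAgent.SatisfiesSP PX PY γ θ c U → MinAgent.SatisfiesFP PX PY γ θ c U) ∧
    -- (b), for all histories at once and then for a single history
    (∀ U : (s : ℕ) → MinAgent.History (X × Y) s → ℝ, MinAgent.SatisfiesFP PX PY γ θ c U →
      ((∀ t w, MinAgent.Transversality PX PY γ U t w) → MinAgent.SatisfiesSP PX PY γ θ c U) ∧
      (∀ t w, MinAgent.Transversality PX PY γ U t w →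
        MinAgent.IsSeqValue PX PY γ θ c t w (U t w))) := by
  have hFP : ∀ {U t w}, MinAgent.SatisfiesFP PX PY γ θ c U →
      MinAgent.Transversality PX PY γ U t w → MinAgent.IsSeqValue PX PY γ θ c t w (U t w) :=
    fun hU htr => hU.isSeqValue hγ0 hθ htr
  refine ⟨fun U _ hSP => ?_, fun U hU => ⟨fun htr t w => hFP hU (htr t w), fun t w => hFP hU⟩⟩
  obtain ⟨C, hC⟩ := hcb
  obtain ⟨V, hV, K, hK⟩ := MinAgent.exists_bounded_satisfiesFP (PX := PX) (PY := PY)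
    hγ0.le hγ1 hθ hc hC
  -- Both are the least element of the same set at every history.
  have hUV : U = V := funext fun t => funext fun w => EReal.coe_injective
    ((hSP t w).unique
      (hFP hV (MinAgent.transversality_of_bounded hγ0 hγ1 hV.measurable hK t w)))
  exact hUV ▸ hV
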